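/- **Setting.** Let $a<b$ be real numbers and let $X$ be a compact Hausdorff smooth manifold with corners of dimension $n$, modelled on $[0,\infty)^n$. Let $\pi:X\to[a,b]$ be a smooth function. Put $X_-=\pi^{-1}(a)$, $X_+=\pi^{-1}(b)$ and $B=\overline{\partial X\setminus(X_-\cup X_+)}$. Assume that $X$ is a cobordism of manifolds with boundary from $X_-$ to $X_+$: $X_-$ and $X_+$ are contained in $\partial X$, and each of $X_-$, $X_+$, $B$ is, near each of its points $p$, equal to exactly one of the local boundary faces $\{x_j=0\}$ of $X$ through $p$. (So $X$ has corners only of codimension two, exactly along $\partial X_\pm=X_\pm\cap B$.) A critical point of $\pi|_B$ is a point $p\in B$ at which $d\pi_p$ vanishes on $T_pB$. The function $\pi$ is called *tame* if $d\pi_p\neq 0$ for all $p\in X$ and the critical points of $\pi|_B$ are isolated and have pairwise distinct values, all lying in the open interval $(a,b)$. A critical point $p$ of $\pi|_B$ is *of type D* if $d\pi_p(\eta)>0$ for vectors $\eta\in T_pX$ pointing outward through $B$. Let $\mathrm{Sec}$ be the space of continuous sections $\sigma:[a,b]\to X$ of $\pi$ (that is, $\pi\circ\sigma=\mathrm{id}$),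 and let $\mathrm{Hom}$ be the space of continuous maps $\gamma:[a,b]\to X$ with $\gamma(a)\in\pi^{-1}(a)$ and $\gamma(b)\in\pi^{-1}(b)$, both with the compact-open topology. The map $\pi$ is *0-sectional* if the inclusion $\mathrm{Sec}\to\mathrm{Hom}$ induces a bijection on sets of path components. **Proposition.** If $\pi:X\to[a,b]$ is a tame function such that $\pi|_B$ has a unique critical point, and this point is of type D, then $\pi$ is 0-sectional. Explicitly: every $\gamma\in\mathrm{Hom}$ is homotopic, through maps in $\mathrm{Hom}$, to a section $\sigma\in\mathrm{Sec}$; and if $\sigma'\in\mathrm{Sec}$ is also homotopic to $\gamma$ through maps in $\mathrm{Hom}$, then $\sigma$ and $\sigma'$ are homotopic through sections. -/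

import Mathlib

open scoped Manifold ContDiff
open Set Filter Topology

namespace TameFunctions

section Cobordism

variable {n : ℕ} {X : Type*} [TopologicalSpace X] [ChartedSpace (EuclideanQuadrant n) X]

/-- The coordinate vector of `q` in the preferred chart around `p`, on an `n`-dimensional manifold
with corners (locally modelled on `[0,∞)ⁿ`). -/
noncomputable def coord (p q : X) : EuclideanSpace ℝ (Fin n) :=
  extChartAt (modelWithCornersEuclideanQuadrant n) p q

/-- Near `p`, the set `S` is the local boundary hypersurface (face) `{xⱼ = 0}` through `p`. -/
def IsFaceAt (S : Set X) (p : X) (j : Fin n) : Prop :=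
  coord p p j = 0 ∧ ∀ᶠ q in 𝓝 p, q ∈ S ↔ coord p q j = 0

variable (n) in
/-- The side boundary `B` of a cobordism with ends `Xm` and `Xp`: the closure of
`∂X ∖ (Xm ∪ Xp)`. -/
def sideBoundary (Xm Xp : Set X) : Set X :=
  closure ((modelWithCornersEuclideanQuadrant n).boundary X \ (Xm ∪ Xp))

variable (n) in
/-- `X` is a cobordism, of manifolds with boundary, from `Xm` to `Xp`: the boundary of `X` is
`Xm ∪ B ∪ Xp` with `Xm`, `Xp` closed and disjoint, and each of `Xm`, `Xp`, `B` is near each of its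
points exactly one of the local faces of `X`. Thus `Xm`, `Xp`, `B` are manifolds with boundary, and
`X` has corners exactly (and only of codimension two) along `∂Xm = Xm ∩ B` and
`∂Xp = Xp ∩ B`. -/
structure IsCobordism (Xm Xp : Set X) : Prop where
  isClosed_left : IsClosed Xm
  isClosed_right : IsClosed Xp
  disjoint : Disjoint Xm Xp
  left_subset : Xm ⊆ (modelWithCornersEuclideanQuadrant n).boundary X
  right_subset : Xp ⊆ (modelWithCornersEuclideanQuadrant n).boundary X
  face_left : ∀ p ∈ Xm, ∃ j : Fin n, IsFaceAt Xm p j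
  face_right : ∀ p ∈ Xp, ∃ j : Fin n, IsFaceAt Xp p j
  face_side : ∀ p ∈ sideBoundary n Xm Xp, ∃ j : Fin n, IsFaceAt (sideBoundary n Xm Xp) p j

/-- The differential of `f : X → ℝ` at `p`. The tangent space `T_pX` is identified with `ℝⁿ` by the
preferred chart around `p`. -/
noncomputable def differential (f : X → ℝ) (p : X) : EuclideanSpace ℝ (Fin n) →L[ℝ] ℝ :=
  mfderiv (modelWithCornersEuclideanQuadrant n) 𝓘(ℝ, ℝ) f p

variable (n) in
/-- `p` is a critical point of the restriction of `f` to the hypersurface `B`: `p ∈ B`, and the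
differential of `f` at `p` vanishes on the tangent space `T_pB = {v | vⱼ = 0}`, where `{xⱼ = 0}` is
the face of `X` that agrees with `B` near `p`. -/
def IsCriticalOn (f : X → ℝ) (B : Set X) (p : X) : Prop :=
  p ∈ B ∧ ∃ j : Fin n, IsFaceAt B p j ∧
    ∀ v : EuclideanSpace ℝ (Fin n), v j = 0 → differential f p v = 0

/-- The tangent vector `v ∈ T_pX` points outward through the hypersurface `B`. -/
def IsOutward (B : Set X) (p : X) (v : EuclideanSpace ℝ (Fin n)) : Prop :=
  ∃ j : Fin n, IsFaceAt B p j ∧ v j < 0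

variable (n) in
/-- The point `p` is of type D: the differential of `f` at `p` is positive on outward pointing
vectors. -/
def IsTypeD (f : X → ℝ) (B : Set X) (p : X) : Prop :=
  ∀ v : EuclideanSpace ℝ (Fin n), IsOutward B p v → 0 < differential f p v

end Cobordism

section Tame

variable {X : Type*} [TopologicalSpace X] {a b : ℝ}

/-- The fibre `π⁻¹(a)` over the left end point. -/
def leftFibre (π : C(X, Icc a b)) : Set X := {x | (π x : ℝ) = a}

/-- The fibre `π⁻¹(b)` over the right end point. -/
def rightFibre (π : C(X, Icc a b)) : Set X := {x | (π x : ℝ) = b}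

/-- The side boundary of the cobordism from `π⁻¹(a)` to `π⁻¹(b)`. -/
def side (n : ℕ) [ChartedSpace (EuclideanQuadrant n) X] (π : C(X, Icc a b)) : Set X :=
  sideBoundary n (leftFibre π) (rightFibre π)

/-- `p` is a critical point of the restriction of `π` to the side boundary. -/
def IsSideCritical (n : ℕ) [ChartedSpace (EuclideanQuadrant n) X] (π : C(X, Icc a b)) (p : X) :
    Prop :=
  IsCriticalOn n (fun x => (π x : ℝ)) (side n π) p

/-- `π : X → [a, b]` is a tame function on the `n`-dimensional manifold with corners `X`. -/
structure IsTame (n : ℕ) [ChartedSpace (EuclideanQuadrant n) X] (π : C(X, Icc a b)) : Prop where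
  smooth : ContMDiff (modelWithCornersEuclideanQuadrant n) 𝓘(ℝ, ℝ) ∞ (fun x => (π x : ℝ))
  cobordism : IsCobordism n (leftFibre π) (rightFibre π)
  submersive : ∀ p : X, Function.Surjective (differential (n := n) (fun x => (π x : ℝ)) p)
  isolated : ∀ p, IsSideCritical n π p → ∀ᶠ q in 𝓝 p, IsSideCritical n π q → q = p
  distinct_values : InjOn π {p | IsSideCritical n π p}
  values_mem : ∀ p, IsSideCritical n π p → (π p : ℝ) ∈ Ioo a b

end Tame

section Sectional

variable {X : Type*} [TopologicalSpace X] {a b : ℝ}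

/-- `σ : [a, b] → X` is a section of `p`. -/
def IsSection (p : C(X, Icc a b)) (σ : C(Icc a b, X)) : Prop := ∀ t, p (σ t) = t

/-- `γ` is a map `([a, b], a, b) → (X, p⁻¹(a), p⁻¹(b))`. -/
def IsEndPath (hab : a < b) (p : C(X, Icc a b)) (γ : C(Icc a b, X)) : Prop :=
  γ ⟨a, left_mem_Icc.2 hab.le⟩ ∈ leftFibre p ∧ γ ⟨b, right_mem_Icc.2 hab.le⟩ ∈ rightFibre p

/-- The space of sections of `p`, with the compact-open topology. -/
abbrev Sec (p : C(X, Icc a b)) : Type _ := {σ : C(Icc a b, X) // IsSection p σ}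

/-- The space of maps `([a, b], a, b) → (X, p⁻¹(a), p⁻¹(b))`, with the compact-open topology. -/
abbrev EndPath (hab : a < b) (p : C(X, Icc a b)) : Type _ :=
  {γ : C(Icc a b, X) // IsEndPath hab p γ}

theorem IsSection.isEndPath (hab : a < b) {p : C(X, Icc a b)} {σ : C(Icc a b, X)}
    (h : IsSection p σ) : IsEndPath hab p σ :=
  ⟨congrArg Subtype.val (h _), congrArg Subtype.val (h _)⟩

/-- The inclusion of the space of sections in the space of paths. -/
def secInclusion (hab : a < b) (p : C(X, Icc a b)) : C(Sec p, EndPath hab p) where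
  toFun σ := ⟨σ.1, σ.2.isEndPath hab⟩
  continuous_toFun := by fun_prop

/-- The map induced by a continuous map on the sets of path components. -/
def zerothHomotopyMap {Y Z : Type*} [TopologicalSpace Y] [TopologicalSpace Z] (f : C(Y, Z)) :
    ZerothHomotopy Y → ZerothHomotopy Z :=
  ZerothHomotopy.lift (fun y => ZerothHomotopy.mk (f y))
    (fun _ _ h => ZerothHomotopy.sound (h.map f.continuous))

/-- `p` is 0-sectional: the inclusion of the space of sections in the space of paths from `p⁻¹(a)`
to `p⁻¹(b)` is a bijection on sets of path components. -/
def IsZeroSectional (hab : a < b) (p : C(X, Icc a b)) : Prop :=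
  Function.Bijective (zerothHomotopyMap (secInclusion hab p))

end Sectional

end TameFunctions

/-!
The function `π` can be lowered everywhere: a continuous `Φ : X × [a, b] → X` with
`π (Φ (x, t)) = min (π x) t` and `Φ (x, t) = x` for `t ≥ π x` is built (`IsTame.exists_lowering`).
The theorem follows formally from `Φ`. The path `t ↦ Φ (γ b, t)` is a section, `γ` deforms into it
through `Φ (γ t, max t u)` and `Φ (γ (max t u), t)`, and these intermediate maps are sections if `γ`
is one. A homotopy `γₛ` of paths gives the homotopy `Φ (γₛ b, t)` of sections.

A downward flow on `X` would provide `Φ`. It has to exist because at every point outside the bottom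
fibre there is a direction `v` with `dπ v < 0` that does not point out of `X`
(`exists_descending_direction`): at a critical point of type D the inward normal is such a direction,
at the other points of `B` a vector tangent to `B` is, and at the top fibre the inward normal. (At a
critical point where `dπ` is negative on outward vectors there is none.) At the bottom fibre `v` is
the outward normal, followed for as long as it takes to reach the fibre.

No differential equation is solved on the manifold with corners. Pushing along `v` on straight lines
in a chart, damped by a bump function, gives a local descent (`exists_isDescent_push`), a continuous
family of paths that strictly decrease as long as they move. Finitely many local descents are
concatenated and the result iterated until all of `X` lies in the bottom fibre
(`exists_isDescent_to_bottom`). Since the paths strictly decrease, they can be parametrized by height,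
and this is continuous by compactness (`TameFunctions.exists_lowering`).
-/

namespace TameFunctions

/-! ### Descents and their concatenation -/

section Descent

variable {X : Type*} [TopologicalSpace X]

/-- A continuous family of paths `s ↦ G x s`, starting at time `0` in `x`, along which the height
`h` decreases, and strictly so as long as the path moves. Being defined for all real times, resting
at `x` for `s ≤ 0`, descents can be concatenated by a single formula. -/
structure IsDescent (h : X → ℝ) (G : X → ℝ → X) : Prop where
  continuous : Continuous fun q : X × ℝ => G q.1 q.2
  start : ∀ x s, s ≤ 0 → G x s = x
  anti : ∀ x, Antitone fun s => h (G x s)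
  rigid : ∀ x s s', h (G x s) = h (G x s') → G x s = G x s'

namespace IsDescent

variable {h : X → ℝ} {G G₁ G₂ : X → ℝ → X}

theorem le (hG : IsDescent h G) (x : X) (s : ℝ) : h (G x s) ≤ h x := by
  have := hG.anti x (min_le_left s 0)
  simpa [hG.start x _ (min_le_right s 0)] using this

theorem eq_of_height_eq (hG : IsDescent h G) {x : X} {s : ℝ} (e : h (G x s) = h x) :
    G x s = x := by
  rw [← hG.start x 0 le_rfl] at e
  exact (hG.rigid x s 0 (by rwa [hG.start x 0 le_rfl] at e ⊢)).trans (hG.start x 0 le_rfl)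

theorem continuous_at_time (hG : IsDescent h G) (s : ℝ) : Continuous fun x => G x s :=
  hG.continuous.comp (by fun_prop : Continuous fun x : X => (x, s))

theorem const (h : X → ℝ) : IsDescent h fun x _ => x :=
  ⟨continuous_fst, fun _ _ _ => rfl, fun _ _ _ _ => le_rfl, fun _ _ _ _ => rfl⟩

/-- The descent that follows `G₁` until time `T` and then `G₂`. -/
theorem concat (h₁ : IsDescent h G₁) (h₂ : IsDescent h G₂) {T : ℝ} (hT : 0 ≤ T) :
    IsDescent h fun x s => G₂ (G₁ x (min s T)) (s - T) := by
  have early : ∀ x s, s ≤ T → G₂ (G₁ x (min s T)) (s - T) = G₁ x s := fun x s hs => by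
    rw [h₂.start _ _ (by linarith), min_eq_left hs]
  have late : ∀ x s, T ≤ s → G₂ (G₁ x (min s T)) (s - T) = G₂ (G₁ x T) (s - T) := fun x s hs => by
    rw [min_eq_right hs]
  have anti : ∀ x, Antitone fun s => h (G₂ (G₁ x (min s T)) (s - T)) := fun x s s' hss => by
    rcases le_total s T with hs | hs
    · simp only [early x s hs]
      exact (h₂.le _ _).trans (h₁.anti x (le_min hss hs))
    · simp only [late x s hs, late x s' (hs.trans hss)]
      exact h₂.anti _ (by linarith)
  refine ⟨?_, fun x s hs => ?_, anti, ?_⟩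
  · have e₁ : Continuous fun q : X × ℝ => G₁ q.1 (min q.2 T) :=
      h₁.continuous.comp (by fun_prop : Continuous fun q : X × ℝ => (q.1, min q.2 T))
    exact h₂.continuous.comp (e₁.prodMk (continuous_snd.sub continuous_const))
  · rw [early x s (hs.trans hT), h₁.start x s hs]
  · intro x
    -- by symmetry the second time may be taken to be the later one
    suffices H : ∀ s s', s ≤ s' →
        h (G₂ (G₁ x (min s T)) (s - T)) = h (G₂ (G₁ x (min s' T)) (s' - T)) →
        G₂ (G₁ x (min s T)) (s - T) = G₂ (G₁ x (min s' T)) (s' - T) by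
      intro s s' e
      rcases le_total s s' with hs | hs
      · exact H s s' hs e
      · exact (H s' s hs e.symm).symm
    intro s s' hss e
    rcases le_total s T with hs | hs
    · rcases le_total s' T with hs' | hs'
      · simp only [early x s hs, early x s' hs'] at e ⊢
        exact h₁.rigid x _ _ e
      · -- the height at time `T` lies between the two equal heights
        simp only [early x s hs, late x s' hs'] at e ⊢
        have e₁ : h (G₁ x T) ≤ h (G₁ x s) := h₁.anti x hs
        have e₂ := h₂.le (G₁ x T) (s' - T)
        rw [h₂.eq_of_height_eq (le_antisymm e₂ (e ▸ e₁))]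
        exact h₁.rigid x _ _ (le_antisymm (e ▸ e₂) e₁)
    · simp only [late x s hs, late x s' (hs.trans hss)] at e ⊢
      exact h₂.rigid _ _ _ e

end IsDescent

/-- Finitely many local descents compose to one that lowers every point above the bottom level `a`
and carries a neighbourhood of the bottom level into it. -/
theorem exists_isDescent_strict [CompactSpace X] {h : X → ℝ} {a : ℝ} (ha : ∀ x, a ≤ h x)
    (hh : Continuous h)
    (local_descent : ∀ z, ∃ G, IsDescent h G ∧ (a < h z → h (G z 1) < h z) ∧
      (h z = a → ∀ᶠ x in 𝓝 z, h (G x 1) = a)) :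
    ∃ G T, 0 ≤ T ∧ IsDescent h G ∧ (∀ z, a < h z → h (G z T) < h z) ∧
      ∀ z, h z = a → ∀ᶠ x in 𝓝 z, h (G x T) = a := by
  have key : ∃ G T, 0 ≤ T ∧ IsDescent h G ∧ (∀ z ∈ (univ : Set X), a < h z → h (G z T) < h z) ∧
      ∀ z ∈ (univ : Set X), h z = a → ∀ᶠ x in 𝓝 z, h (G x T) = a := by
    refine isCompact_univ.induction_on (p := fun S => ∃ G T, 0 ≤ T ∧ IsDescent h G ∧
      (∀ z ∈ S, a < h z → h (G z T) < h z) ∧ ∀ z ∈ S, h z = a → ∀ᶠ x in 𝓝 z, h (G x T) = a)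
      ⟨fun x _ => x, 0, le_rfl, .const h, by simp, by simp⟩ ?_ ?_ ?_
    · rintro S S' hS ⟨G, T, hT, hG, h₁, h₂⟩
      exact ⟨G, T, hT, hG, fun z hz => h₁ z (hS hz), fun z hz => h₂ z (hS hz)⟩
    · rintro S S' ⟨G, T, hT, hG, h₁, h₂⟩ ⟨G', T', hT', hG', h₁', h₂'⟩
      refine ⟨_, T + T', by positivity, hG.concat hG' hT, fun z hz haz => ?_, fun z hz haz => ?_⟩
      all_goals simp only [min_eq_right (le_add_of_nonneg_right hT'), add_sub_cancel_left]
      · by_cases e : h (G z T) = h z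
        · have hz' : z ∈ S' := hz.resolve_left fun hz => (h₁ z hz haz).ne e
          rw [hG.eq_of_height_eq e]
          exact h₁' z hz' haz
        · exact (hG'.le _ _).trans_lt (lt_of_le_of_ne (hG.le _ _) e)
      · rcases hz with hz | hz
        · filter_upwards [h₂ z hz haz] with x hx
          exact le_antisymm (hx ▸ hG'.le _ _) (ha _)
        · have e : G z T = z := hG.eq_of_height_eq (le_antisymm (hG.le _ _) (haz ▸ ha _))
          have lim : Tendsto (fun x => G x T) (𝓝 z) (𝓝 z) := by
            simpa only [e] using (hG.continuous_at_time T).tendsto z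
          exact lim.eventually (h₂' z hz haz)
    · intro z _
      obtain ⟨G, hG, h₁, h₂⟩ := local_descent z
      rcases (ha z).lt_or_eq with hz | hz
      · refine ⟨{x | a < h x ∧ h (G x 1) < h x}, nhdsWithin_le_nhds ?_, G, 1, zero_le_one, hG,
          fun x hx _ => hx.2, fun x hx e => absurd hx.1 e.le.not_gt⟩
        exact (hh.tendsto z |>.eventually_const_lt hz).and
          (((hh.comp (hG.continuous_at_time 1)).tendsto z).eventually_lt (hh.tendsto z) (h₁ hz))
      · have hev := (h₂ hz.symm).eventually_nhds
        refine ⟨{x | ∀ᶠ y in 𝓝 x, h (G y 1) = a}, nhdsWithin_le_nhds hev, G, 1, zero_le_one, hG,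
          fun x hx hax => ?_, fun x hx _ => hx⟩
        have : h (G x 1) = a := (show ∀ᶠ y in 𝓝 x, h (G y 1) = a from hx).self_of_nhds
        rwa [this]
  simpa using key

/-- On a compact space, a descent that lowers every point above the bottom level and carries a
neighbourhood of the bottom level into it can be iterated until everything lies at the bottom. -/
theorem exists_isDescent_to_bottom [CompactSpace X] {h : X → ℝ} {a : ℝ} (ha : ∀ x, a ≤ h x)
    (hh : Continuous h)
    (local_descent : ∀ z, ∃ G, IsDescent h G ∧ (a < h z → h (G z 1) < h z) ∧
      (h z = a → ∀ᶠ x in 𝓝 z, h (G x 1) = a)) :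
    ∃ G T, 0 ≤ T ∧ IsDescent h G ∧ ∀ x, h (G x T) = a := by
  obtain ⟨G, T, hT, hG, lower, bottom⟩ := exists_isDescent_strict ha hh local_descent
  -- away from the neighbourhood that is carried to the bottom, the drop is bounded below
  obtain ⟨δ, hδ, drop⟩ : ∃ δ > 0, ∀ x, h (G x T) = a ∨ h (G x T) ≤ h x - δ := by
    set U : Set X := {x | ∀ᶠ y in 𝓝 x, h (G y T) = a}
    have hU : IsOpen U := isOpen_setOfPred_eventually_nhds
    have hK : IsCompact Uᶜ := hU.isClosed_compl.isCompact
    obtain ⟨δ, hδ, hle⟩ : ∃ δ > 0, ∀ x ∈ Uᶜ, δ ≤ h x - h (G x T) := by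
      refine hK.exists_forall_le' (a := 0)
        (hh.sub (hh.comp (hG.continuous_at_time T))).continuousOn fun x hx => ?_
      have : a < h x := lt_of_le_of_ne (ha x) fun e => hx (bottom x e.symm)
      exact sub_pos.2 (lower x this)
    refine ⟨δ, hδ, fun x => ?_⟩
    by_cases hx : x ∈ U
    · exact .inl (show ∀ᶠ y in 𝓝 x, h (G y T) = a from hx).self_of_nhds
    · exact .inr (by linarith [hle x hx])
  have iter : ∀ N : ℕ, ∃ G T, 0 ≤ T ∧ IsDescent h G ∧
      ∀ x, h (G x T) = a ∨ h (G x T) ≤ h x - N * δ := by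
    intro N
    induction N with
    | zero => exact ⟨fun x _ => x, 0, le_rfl, .const h, by simp⟩
    | succ N ih =>
      obtain ⟨G', T', hT', hG', drop'⟩ := ih
      refine ⟨_, T + T', by positivity, hG.concat hG' hT, fun x => ?_⟩
      simp only [min_eq_right (le_add_of_nonneg_right hT'), add_sub_cancel_left]
      rcases drop x with e | e
      · exact .inl (le_antisymm (e ▸ hG'.le _ _) (ha _))
      · rcases drop' (G x T) with e' | e'
        · exact .inl e'
        · right
          push_cast
          linarith
  obtain ⟨M, hM⟩ := isCompact_univ.bddAbove_image hh.continuousOn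
  obtain ⟨N, hN⟩ := exists_nat_gt ((M - a) / δ)
  obtain ⟨G', T', hT', hG', drop'⟩ := iter N
  refine ⟨G', T', hT', hG', fun x => (drop' x).resolve_right fun e => ?_⟩
  have hx : h x ≤ M := hM ⟨x, trivial, rfl⟩
  rw [div_lt_iff₀ hδ] at hN
  linarith [ha (G' x T')]

/-- A descent to the bottom can be parametrized by height: `Φ (x, t)` is the point at height `t` on
the way down from `x`, and it is `x` if `t` is above `x`. Continuity in `(x, t)` holds because
`(x, s) ↦ (x, h (G x s))` is a quotient map onto the region `t ≤ h x`, by compactness. -/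
theorem exists_lowering [T2Space X] [CompactSpace X] {a b : ℝ} (p : C(X, Icc a b))
    {G : X → ℝ → X} {T : ℝ} (hT : 0 ≤ T) (hG : IsDescent (fun x => (p x : ℝ)) G)
    (hbot : ∀ x, (p (G x T) : ℝ) = a) :
    ∃ Φ : C(X × Icc a b, X), (∀ x t, p (Φ (x, t)) = min (p x) t) ∧
      ∀ x t, p x ≤ t → Φ (x, t) = x := by
  let R := {q : X × Icc a b // q.2 ≤ p q.1}
  let quo : X × Icc (0 : ℝ) T → R := fun q => ⟨(q.1, p (G q.1 q.2)), hG.le _ _⟩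
  have hcont : Continuous fun q : X × Icc (0 : ℝ) T => G q.1 q.2 :=
    hG.continuous.comp (by fun_prop : Continuous fun q : X × Icc (0 : ℝ) T => (q.1, (q.2 : ℝ)))
  have hquo : Continuous quo :=
    Continuous.subtype_mk (continuous_fst.prodMk (p.continuous.comp hcont)) _
  have hsurj : Function.Surjective quo := by
    rintro ⟨⟨x, t⟩, ht⟩
    have hx : Continuous fun s => (p (G x s) : ℝ) :=
      continuous_subtype_val.comp (p.continuous.comp
        (hG.continuous.comp (by fun_prop : Continuous fun s : ℝ => (x, s))))
    have : (t : ℝ) ∈ Icc ((p (G x T) : ℝ)) (p (G x 0)) := by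
      rw [hbot, hG.start x 0 le_rfl]
      exact ⟨t.2.1, ht⟩
    obtain ⟨s, hs, e⟩ := intermediate_value_Icc' hT hx.continuousOn this
    exact ⟨(x, ⟨s, hs⟩), Subtype.ext (Prod.ext rfl (Subtype.ext e))⟩
  have hq : IsQuotientMap quo := hquo.isClosedMap.isQuotientMap hquo hsurj
  let Ψ : R → X := fun r => G (Function.surjInv hsurj r).1 (Function.surjInv hsurj r).2
  have hΨ : ∀ q, Ψ (quo q) = G q.1 q.2 := fun q => by
    have e : (quo _).1 = (quo q).1 := congrArg Subtype.val (Function.surjInv_eq hsurj (quo q))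
    have e₁ : (Function.surjInv hsurj (quo q)).1 = q.1 :=
      congrArg (fun r : X × Icc a b => r.1) e
    have e₂ := congrArg (fun r : X × Icc a b => (r.2 : ℝ)) e
    simp only [quo, e₁] at e₂
    simp only [Ψ, e₁]
    exact hG.rigid _ _ _ e₂
  have hΨc : Continuous Ψ := hq.continuous_iff.2 (by
    convert hcont using 1
    exact funext hΨ)
  have hΨh : ∀ r, p (Ψ r) = r.1.2 := fun r => by
    obtain ⟨q, rfl⟩ := hsurj r
    rw [hΨ]
  have hΨt : ∀ r : R, r.1.2 = p r.1.1 → Ψ r = r.1.1 := fun r e => by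
    obtain ⟨q, rfl⟩ := hsurj r
    rw [hΨ]
    exact hG.eq_of_height_eq (congrArg Subtype.val e)
  refine ⟨⟨fun q => Ψ ⟨(q.1, min (p q.1) q.2), min_le_left _ _⟩, hΨc.comp ?_⟩, fun x t => ?_,
    fun x t ht => ?_⟩
  · exact Continuous.subtype_mk (by fun_prop) _
  · exact hΨh _
  · exact hΨt _ (min_eq_left ht)

end Descent

/-! ### Sections and paths in the presence of a lowering map -/

section Homotopy

variable {X : Type*} [TopologicalSpace X] {a b : ℝ}

theorem joined_subtype_iff_homotopicWith {Y : Type*} [TopologicalSpace Y] [LocallyCompactSpace Y]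
    {P : C(Y, X) → Prop} (f g : {γ : C(Y, X) // P γ}) :
    Joined f g ↔ f.1.HomotopicWith g.1 P := by
  constructor
  · rintro ⟨q⟩
    let F : C(unitInterval, C(Y, X)) := ⟨fun s => (q s).1, by fun_prop⟩
    refine ⟨⟨⟨F.uncurry, fun y => ?_, fun y => ?_⟩, fun s => ?_⟩⟩
    · simp [F]
    · simp [F]
    · exact (q s).2
  · rintro ⟨H⟩
    exact ⟨⟨⟨fun s => ⟨H.toHomotopy.toContinuousMap.curry s, H.prop' s⟩,
      Continuous.subtype_mk (ContinuousMap.continuous _) _⟩,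
      Subtype.ext (ContinuousMap.ext fun y => H.apply_zero y),
      Subtype.ext (ContinuousMap.ext fun y => H.apply_one y)⟩⟩

theorem homotopicWith_of_interval_family (hab : a < b) {Y : Type*} [TopologicalSpace Y]
    {P : C(Y, X) → Prop} (F : C(Icc a b × Y, X)) (hP : ∀ u, P (F.curry u)) :
    (F.curry ⟨a, left_mem_Icc.2 hab.le⟩).HomotopicWith
      (F.curry ⟨b, right_mem_Icc.2 hab.le⟩) P := by
  have e := (iccHomeoI a b hab).symm.continuous
  refine ⟨⟨⟨⟨fun q => F ((iccHomeoI a b hab).symm q.1, q.2), by fun_prop⟩, fun y => ?_,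
    fun y => ?_⟩, fun s => hP ((iccHomeoI a b hab).symm s)⟩⟩
  · have : (iccHomeoI a b hab).symm 0 = ⟨a, left_mem_Icc.2 hab.le⟩ := by
      ext; simp
    simp [this]
  · have : (iccHomeoI a b hab).symm 1 = ⟨b, right_mem_Icc.2 hab.le⟩ := by
      ext; simp
    simp [this]

variable {p : C(X, Icc a b)} {Φ : C(X × Icc a b, X)}

/-- The section that descends from the end point of `γ`. -/
def sectionBelow (hab : a < b) (Φ : C(X × Icc a b, X)) (γ : C(Icc a b, X)) : C(Icc a b, X) :=
  ⟨fun t => Φ (γ ⟨b, right_mem_Icc.2 hab.le⟩, t), by fun_prop⟩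

theorem isSection_sectionBelow (hab : a < b) (hΦ : ∀ x t, p (Φ (x, t)) = min (p x) t)
    {γ : C(Icc a b, X)} (hγ : IsEndPath hab p γ) : IsSection p (sectionBelow hab Φ γ) := by
  intro t
  have : p (γ ⟨b, right_mem_Icc.2 hab.le⟩) = ⟨b, right_mem_Icc.2 hab.le⟩ := Subtype.ext hγ.2
  simp only [sectionBelow, ContinuousMap.coe_mk, hΦ, this]
  exact min_eq_right t.2.2

/-- Two-stage deformation of `γ` to the section below its end point: first `γ t` descends to height
at most `t`, then the starting point of the descent moves along `γ` to the end. -/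
theorem homotopicWith_sectionBelow (hab : a < b) (hΦ' : ∀ x t, p x ≤ t → Φ (x, t) = x)
    {P : C(Icc a b, X) → Prop} {γ : C(Icc a b, X)}
    (h₁ : ∀ γ' : C(Icc a b, X), ∀ u, (∀ t, γ' t = Φ (γ t, max t u)) → P γ')
    (h₂ : ∀ γ' : C(Icc a b, X), ∀ u, (∀ t, γ' t = Φ (γ (max t u), t)) → P γ') :
    γ.HomotopicWith (sectionBelow hab Φ γ) P := by
  let F₁ : C(Icc a b × Icc a b, X) := ⟨fun q => Φ (γ q.2, max q.2 q.1), by fun_prop⟩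
  let F₂ : C(Icc a b × Icc a b, X) := ⟨fun q => Φ (γ (max q.2 q.1), q.2), by fun_prop⟩
  have H₁ := (homotopicWith_of_interval_family hab F₁ fun u => h₁ _ u fun t => rfl).symm
  have H₂ := homotopicWith_of_interval_family hab F₂ fun u => h₂ _ u fun t => rfl
  have e₁ : F₁.curry ⟨b, right_mem_Icc.2 hab.le⟩ = γ := by
    ext t
    exact hΦ' _ _ ((p (γ t)).2.2.trans (le_max_right (t : ℝ) b))
  have e₂ : F₁.curry ⟨a, left_mem_Icc.2 hab.le⟩ = F₂.curry ⟨a, left_mem_Icc.2 hab.le⟩ := by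
    ext t
    have : max t ⟨a, left_mem_Icc.2 hab.le⟩ = t := max_eq_left t.2.1
    simp [F₁, F₂, this]
  have e₃ : F₂.curry ⟨b, right_mem_Icc.2 hab.le⟩ = sectionBelow hab Φ γ := by
    ext t
    have : max t ⟨b, right_mem_Icc.2 hab.le⟩ = ⟨b, right_mem_Icc.2 hab.le⟩ := max_eq_right t.2.2
    simp [F₂, sectionBelow, this]
  rw [e₁, e₂] at H₁
  rw [e₃] at H₂
  exact H₁.trans H₂

theorem IsEndPath.homotopicWith_sectionBelow (hab : a < b)
    (hΦ : ∀ x t, p (Φ (x, t)) = min (p x) t) (hΦ' : ∀ x t, p x ≤ t → Φ (x, t) = x)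
    {γ : C(Icc a b, X)} (hγ : IsEndPath hab p γ) :
    γ.HomotopicWith (sectionBelow hab Φ γ) (IsEndPath hab p) := by
  have ha : p (γ ⟨a, left_mem_Icc.2 hab.le⟩) = ⟨a, left_mem_Icc.2 hab.le⟩ := Subtype.ext hγ.1
  have hb : p (γ ⟨b, right_mem_Icc.2 hab.le⟩) = ⟨b, right_mem_Icc.2 hab.le⟩ := Subtype.ext hγ.2
  have ma : ∀ u : Icc a b, min (⟨a, left_mem_Icc.2 hab.le⟩ : Icc a b) u =
    ⟨a, left_mem_Icc.2 hab.le⟩ := fun u => min_eq_left u.2.1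
  have mb : ∀ u : Icc a b, max (⟨b, right_mem_Icc.2 hab.le⟩ : Icc a b) u =
    ⟨b, right_mem_Icc.2 hab.le⟩ := fun u => max_eq_left u.2.2
  refine TameFunctions.homotopicWith_sectionBelow hab hΦ' (fun γ' u e => ⟨?_, ?_⟩)
    fun γ' u e => ⟨?_, ?_⟩
  · simp [leftFibre, e, hΦ, ha]
  · simp [rightFibre, e, hΦ, hb, mb]
  · rw [leftFibre, mem_ofPred_eq, e, hΦ, min_comm, ma]
  · rw [rightFibre, mem_ofPred_eq, e, hΦ, mb, hb, min_self]

theorem IsSection.homotopicWith_sectionBelow (hab : a < b)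
    (hΦ : ∀ x t, p (Φ (x, t)) = min (p x) t) (hΦ' : ∀ x t, p x ≤ t → Φ (x, t) = x)
    {σ : C(Icc a b, X)} (hσ : IsSection p σ) :
    σ.HomotopicWith (sectionBelow hab Φ σ) (IsSection p) := by
  refine TameFunctions.homotopicWith_sectionBelow hab hΦ' (fun γ' u e t => ?_)
    fun γ' u e t => ?_
  · rw [e, hΦ, hσ, min_eq_left (le_max_left _ _)]
  · rw [e, hΦ, hσ, min_eq_right (le_max_left _ _)]

/-- The end points of a homotopy through paths trace a path in the top fibre, and descending from
it gives a homotopy through sections. -/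
theorem sectionBelow_homotopicWith (hab : a < b) (hΦ : ∀ x t, p (Φ (x, t)) = min (p x) t)
    {γ γ' : C(Icc a b, X)} (H : γ.HomotopicWith γ' (IsEndPath hab p)) :
    (sectionBelow hab Φ γ).HomotopicWith (sectionBelow hab Φ γ') (IsSection p) := by
  obtain ⟨H⟩ := H
  refine ⟨⟨⟨⟨fun q => Φ (H (q.1, ⟨b, right_mem_Icc.2 hab.le⟩), q.2), by fun_prop⟩, fun t => ?_,
    fun t => ?_⟩, fun s => ?_⟩⟩
  · simp [sectionBelow]
  · simp [sectionBelow]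
  · exact isSection_sectionBelow hab hΦ (H.prop' s)

theorem IsSection.homotopicWith_of_isEndPath (hab : a < b)
    (hΦ : ∀ x t, p (Φ (x, t)) = min (p x) t) (hΦ' : ∀ x t, p x ≤ t → Φ (x, t) = x)
    {σ σ' : C(Icc a b, X)} (hσ : IsSection p σ) (hσ' : IsSection p σ')
    (H : σ.HomotopicWith σ' (IsEndPath hab p)) : σ.HomotopicWith σ' (IsSection p) :=
  (hσ.homotopicWith_sectionBelow hab hΦ hΦ').trans
    ((sectionBelow_homotopicWith hab hΦ H).trans
      (hσ'.homotopicWith_sectionBelow hab hΦ hΦ').symm)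

theorem isZeroSectional_of_lowering (hab : a < b)
    (hΦ : ∀ x t, p (Φ (x, t)) = min (p x) t) (hΦ' : ∀ x t, p x ≤ t → Φ (x, t) = x) :
    IsZeroSectional hab p := by
  constructor
  · intro c c'
    induction c with | mk σ
    induction c' with | mk σ'
    intro e
    have J : Joined (secInclusion hab p σ) (secInclusion hab p σ') := Quotient.exact e
    exact Quotient.sound ((joined_subtype_iff_homotopicWith σ σ').2
      (σ.2.homotopicWith_of_isEndPath hab hΦ hΦ' σ'.2
        ((joined_subtype_iff_homotopicWith _ _).1 J)))
  · intro c
    induction c with | mk γ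
    let σ : Sec p := ⟨_, isSection_sectionBelow hab hΦ γ.2⟩
    refine ⟨ZerothHomotopy.mk σ, Quotient.sound ?_⟩
    exact ((joined_subtype_iff_homotopicWith γ (secInclusion hab p σ)).2
      (γ.2.homotopicWith_sectionBelow hab hΦ hΦ')).symm

end Homotopy

/-! ### Pushing along straight lines in a chart -/

section LocalDescent

local notation "𝓠" => modelWithCornersEuclideanQuadrant

variable {n : ℕ} {X : Type*} [TopologicalSpace X] [ChartedSpace (EuclideanQuadrant n) X]

theorem mem_range_quadrant {y : EuclideanSpace ℝ (Fin n)} : y ∈ range (𝓠 n) ↔ ∀ i, 0 ≤ y i :=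
  Set.ext_iff.1 (range_euclideanQuadrant n) y

theorem coord_nonneg (z x : X) (i : Fin n) : 0 ≤ coord z x i :=
  mem_range_quadrant.1 (mem_range_self _) i

theorem add_smul_single_mem_range {y : EuclideanSpace ℝ (Fin n)} (hy : y ∈ range (𝓠 n))
    (j : Fin n) {s : ℝ} (hs : 0 ≤ s) : y + s • EuclideanSpace.single j 1 ∈ range (𝓠 n) := by
  refine mem_range_quadrant.2 fun i => ?_
  have := mem_range_quadrant.1 hy i
  by_cases e : i = j <;> simp [e, add_nonneg, hs, mem_range_quadrant.1 hy]

variable {h : X → ℝ}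

theorem hasFDerivWithinAt_differential (hh : ContMDiff (𝓠 n) 𝓘(ℝ, ℝ) ∞ h) (z : X) :
    HasFDerivWithinAt (h ∘ (extChartAt (𝓠 n) z).symm) (differential (n := n) h z) (range (𝓠 n))
      (extChartAt (𝓠 n) z z) :=
  ((hh z).mdifferentiableAt (by simp)).hasMFDerivAt.2

/-- Near `z`, a smooth function strictly decreases along the straight chart segments in a direction
in which its differential at `z` is negative. -/
theorem exists_ball_strictAnti [IsManifold (𝓠 n) ∞ X] (hh : ContMDiff (𝓠 n) 𝓘(ℝ, ℝ) ∞ h) {z : X}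
    {v : EuclideanSpace ℝ (Fin n)} (hv : differential h z v < 0) :
    ∃ r > 0, Metric.ball (extChartAt (𝓠 n) z z) r ∩ range (𝓠 n) ⊆ (extChartAt (𝓠 n) z).target ∧
      ∀ y ∈ Metric.ball (extChartAt (𝓠 n) z z) r ∩ range (𝓠 n), ∀ s : ℝ, 0 < s →
        y + s • v ∈ Metric.ball (extChartAt (𝓠 n) z z) r ∩ range (𝓠 n) →
        h ((extChartAt (𝓠 n) z).symm (y + s • v)) < h ((extChartAt (𝓠 n) z).symm y) := by
  set φ := extChartAt (𝓠 n) z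
  set g : EuclideanSpace ℝ (Fin n) → ℝ := h ∘ φ.symm
  have hg : ContDiffOn ℝ ∞ g φ.target :=
    (hh.comp_contMDiffOn (contMDiffOn_extChartAt_symm z)).contDiffOn
  have hu : UniqueDiffOn ℝ φ.target := uniqueDiffOn_extChartAt_target z
  have hz : φ z ∈ φ.target := mem_extChartAt_target z
  have hd : fderivWithin ℝ g φ.target (φ z) = differential h z :=
    ((hasFDerivWithinAt_differential hh z).mono (extChartAt_target_subset_range z)).fderivWithin
      (hu _ hz)
  have hneg : ∀ᶠ y in 𝓝[φ.target] φ z, fderivWithin ℝ g φ.target y v < 0 := by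
    have hc : ContinuousWithinAt (fun y => fderivWithin ℝ g φ.target y v) φ.target (φ z) :=
      ((hg.continuousOn_fderivWithin hu (by simp)) _ hz).clm_apply continuousWithinAt_const
    exact hc.tendsto.eventually_lt_const (by simpa only [hd] using hv)
  have hT : 𝓝[φ.target] φ z = 𝓝[range (𝓠 n)] φ z := nhdsWithin_extChartAt_target_eq z
  have hmem : {y | y ∈ φ.target ∧ fderivWithin ℝ g φ.target y v < 0} ∈ 𝓝[range (𝓠 n)] φ z := by
    rw [← hT]
    exact eventually_mem_nhdsWithin.and hneg
  obtain ⟨r, hr, hball⟩ := Metric.mem_nhdsWithin_iff.1 hmem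
  refine ⟨r, hr, fun y hy => (hball hy).1, fun y hy s hs hys => ?_⟩
  have hconv : Convex ℝ (Metric.ball (φ z) r ∩ range (𝓠 n)) :=
    (convex_ball _ _).inter (𝓠 n).convex_range
  have hmaps : MapsTo (fun t : ℝ => y + t • v) (Icc 0 s) (Metric.ball (φ z) r ∩ range (𝓠 n)) := by
    intro t ht
    have := hconv.add_smul_mem hy hys (t := t / s)
      ⟨div_nonneg ht.1 hs.le, div_le_one_of_le₀ ht.2 hs.le⟩
    rwa [smul_smul, div_mul_cancel₀ _ hs.ne'] at this
  have hderiv : ∀ t ∈ Icc 0 s, HasDerivWithinAt (fun t : ℝ => g (y + t • v))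
      (fderivWithin ℝ g φ.target (y + t • v) v) (Icc 0 s) t := by
    intro t ht
    have h₁ := ((hg.differentiableOn (by simp)) _ (hball (hmaps ht)).1).hasFDerivWithinAt
    have h₂ : HasDerivWithinAt (fun t : ℝ => y + t • v) v (Icc 0 s) t := by
      simpa using (((hasDerivAt_id t).smul_const v).const_add y).hasDerivWithinAt
    exact h₁.comp_hasDerivWithinAt t h₂ fun t ht => (hball (hmaps ht)).1
  have anti : StrictAntiOn (fun t : ℝ => g (y + t • v)) (Icc 0 s) := by
    refine strictAntiOn_of_deriv_neg (convex_Icc _ _)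
      (fun t ht => (hderiv t ht).continuousWithinAt) fun t ht => ?_
    have ht' := interior_subset ht
    rw [((hderiv t ht').hasDerivAt (mem_interior_iff_mem_nhds.1 ht)).deriv]
    exact (hball (hmaps ht')).2
  simpa [g] using anti (left_mem_Icc.2 hs.le) (right_mem_Icc.2 hs.le) hs

/-- Pushing the points near `z` along straight chart segments in the direction `v` is a descent. The
point `x` is pushed for a time of at most `m`, a function of its chart coordinate `y`; this lets the
descent stop at a boundary face. A bump function damps the push away from `z`. -/
theorem exists_isDescent_push [T2Space X] [CompactSpace X] [IsManifold (𝓠 n) ∞ X]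
    (hh : ContMDiff (𝓠 n) 𝓘(ℝ, ℝ) ∞ h) {z : X}
    {v : EuclideanSpace ℝ (Fin n)} (hv : differential h z v < 0)
    {m : EuclideanSpace ℝ (Fin n) → ℝ} (hm : Continuous m) (hm₀ : ∀ y ∈ range (𝓠 n), 0 ≤ m y)
    (hdir : ∀ᶠ y in 𝓝[range (𝓠 n)] extChartAt (𝓠 n) z z, ∀ s, 0 ≤ s → s ≤ m y →
      y + s • v ∈ range (𝓠 n)) :
    ∃ ε > 0, ∃ G, IsDescent h G ∧ ∀ᶠ x in 𝓝 z,
      extChartAt (𝓠 n) z (G x 1) =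
        extChartAt (𝓠 n) z x + min ε (m (extChartAt (𝓠 n) z x)) • v := by
  classical
  obtain ⟨r, hr, hsub, hlt⟩ := exists_ball_strictAnti hh hv
  set φ := extChartAt (𝓠 n) z with hφ
  set N := Metric.ball (φ z) r ∩ range (𝓠 n)
  obtain ⟨r', hr', hdir'⟩ := Metric.mem_nhdsWithin_iff.1 hdir
  -- the chart neighbourhood `U` in which points are moved
  let U : Set X := φ.source ∩ φ ⁻¹' (Metric.ball (φ z) (min (r / 2) r'))
  have hUo : IsOpen U :=
    (continuousOn_extChartAt z).isOpen_inter_preimage (isOpen_extChartAt_source z)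
      Metric.isOpen_ball
  have hzU : z ∈ U := ⟨mem_extChartAt_source z, Metric.mem_ball_self (by positivity)⟩
  obtain ⟨K, hK, hKc, hKU⟩ := exists_mem_nhds_isClosed_subset (hUo.mem_nhds hzU)
  obtain ⟨ρ, hρU, hρ1, hρI⟩ := exists_tsupport_one_of_isOpen_isClosed hUo
    isClosed_closure.isCompact hKc hKU
  -- pushing for time at most `ε` moves points by less than `r / 2`
  let ε : ℝ := r / 2 / (‖v‖ + 1)
  have hε : 0 < ε := by positivity
  have hεv : ε * ‖v‖ < r / 2 := by
    have : ε * (‖v‖ + 1) = r / 2 := div_mul_cancel₀ _ (by positivity)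
    linarith
  have hrange : ∀ x, φ x ∈ range (𝓠 n) := fun x => mem_range_self _
  let τ : X → ℝ := fun x => min (ε * ρ x) (m (φ x))
  have hτ0 : ∀ x, 0 ≤ τ x := fun x => le_min (mul_nonneg hε.le (hρI x).1) (hm₀ _ (hrange x))
  let c : ℝ → ℝ := fun s => max 0 (min s 1)
  have hc0 : ∀ s, 0 ≤ c s := fun s => le_max_left _ _
  have hc1 : ∀ s, c s ≤ 1 := fun s => max_le zero_le_one (min_le_right _ _)
  have hcm : Monotone c := fun s s' hs => max_le_max le_rfl (min_le_min_right _ hs)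
  have hN : ∀ x ∈ U, ∀ s, φ x + (c s * τ x) • v ∈ N := by
    intro x hx s
    have hxb := Metric.mem_ball.1 hx.2
    have h₀ : 0 ≤ c s * τ x := mul_nonneg (hc0 s) (hτ0 x)
    have h₁ : c s * τ x ≤ τ x := mul_le_of_le_one_left (hτ0 x) (hc1 s)
    refine ⟨?_, hdir' ⟨Metric.ball_subset_ball (min_le_right _ _) hx.2, hrange x⟩ _ h₀
      (h₁.trans (min_le_right _ _))⟩
    have h₂ : τ x ≤ ε := (min_le_left _ _).trans (mul_le_of_le_one_right hε.le (hρI x).2)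
    have h₃ : ‖(c s * τ x) • v‖ < r / 2 := by
      rw [norm_smul, Real.norm_of_nonneg h₀]
      exact (mul_le_mul_of_nonneg_right (h₁.trans h₂) (norm_nonneg v)).trans_lt hεv
    rw [Metric.mem_ball, dist_eq_norm, add_sub_right_comm]
    calc ‖φ x - φ z + (c s * τ x) • v‖ ≤ ‖φ x - φ z‖ + ‖(c s * τ x) • v‖ := norm_add_le _ _
      _ < r / 2 + r / 2 := by
        rw [← dist_eq_norm]
        exact add_lt_add (hxb.trans_le (min_le_left _ _)) h₃
      _ = r := by ring
  let G : X → ℝ → X := fun x s => if x ∈ U then φ.symm (φ x + (c s * τ x) • v) else x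
  have hGU : ∀ x ∈ U, ∀ s, G x s = φ.symm (φ x + (c s * τ x) • v) := fun x hx s => if_pos hx
  have hG0 : ∀ x s, c s * τ x = 0 → G x s = x := fun x s e => by
    by_cases hx : x ∈ U
    · rw [hGU x hx, e, zero_smul, add_zero, φ.left_inv hx.1]
    · exact if_neg hx
  have hGout : ∀ x ∉ tsupport ρ, ∀ s, G x s = x := fun x hx s => by
    refine hG0 x s ?_
    simp [τ, image_eq_zero_of_notMem_tsupport hx, hm₀ _ (hrange x)]
  have hGlt : ∀ x ∈ U, ∀ s s', c s * τ x < c s' * τ x → h (G x s') < h (G x s) := by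
    intro x hx s s' hss
    have e : φ x + (c s' * τ x) • v
        = φ x + (c s * τ x) • v + (c s' * τ x - c s * τ x) • v := by
      rw [add_assoc, ← add_smul, add_sub_cancel]
    rw [hGU x hx, hGU x hx, e]
    exact hlt _ (hN x hx s) _ (sub_pos.2 hss) (e ▸ hN x hx s')
  refine ⟨ε, hε, G, ⟨?_, fun x s hs => hG0 x s ?_, fun x s s' hss => ?_, fun x s s' e => ?_⟩, ?_⟩
  · rw [continuous_iff_continuousAt]
    rintro ⟨x, s⟩
    by_cases hx : x ∈ U
    · have hUs : U ×ˢ univ ∈ 𝓝 (x, s) := (hUo.prod isOpen_univ).mem_nhds ⟨hx, trivial⟩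
      have hcont : ContinuousOn (fun q : X × ℝ => φ.symm (φ q.1 + (c q.2 * τ q.1) • v))
          (U ×ˢ univ) := by
        have hφc : ContinuousOn (fun q : X × ℝ => φ q.1) (U ×ˢ univ) :=
          (continuousOn_extChartAt z).comp continuousOn_fst fun q hq => hq.1.1
        have hmc : ContinuousOn (fun q : X × ℝ => m (φ q.1)) (U ×ˢ univ) :=
          hm.comp_continuousOn hφc
        have hτc : ContinuousOn (fun q : X × ℝ => τ q.1) (U ×ˢ univ) :=
          ContinuousOn.inf (by fun_prop) hmc
        have hcc : Continuous fun q : X × ℝ => c q.2 := by fun_prop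
        exact (continuousOn_extChartAt_symm z).comp
          (hφc.add ((hcc.continuousOn.mul hτc).smul continuousOn_const))
          fun q hq => hsub (hN q.1 hq.1 q.2)
      exact (hcont.continuousAt hUs).congr
        (eventually_of_mem hUs fun q hq => (hGU q.1 hq.1 q.2).symm)
    · have hV : (tsupport ρ)ᶜ ×ˢ univ ∈ 𝓝 (x, s) :=
        ((isClosed_tsupport ρ).isOpen_compl.prod isOpen_univ).mem_nhds
          ⟨fun hx' => hx (hρU hx'), trivial⟩
      exact continuousAt_fst.congr
        (eventually_of_mem hV fun q hq => (hGout q.1 hq.1 q.2).symm)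
  · have : c s = 0 := max_eq_left ((min_le_left _ _).trans hs)
    rw [this, zero_mul]
  · by_cases hx : x ∈ U
    · rcases (mul_le_mul_of_nonneg_right (hcm hss) (hτ0 x)).eq_or_lt with e | e
      · simp only [hGU x hx, e, le_refl]
      · exact (hGlt x hx s s' e).le
    · simp [G, hx]
  · by_cases hx : x ∈ U
    · rcases lt_trichotomy (c s * τ x) (c s' * τ x) with e' | e' | e'
      · exact absurd e (hGlt x hx s s' e').ne'
      · simp only [hGU x hx, e']
      · exact absurd e (hGlt x hx s' s e').ne
    · simp [G, hx]
  · filter_upwards [hK] with x hx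
    have e : c 1 * τ x = min ε (m (φ x)) := by
      have : ρ x = 1 := hρ1 hx
      simp [c, τ, this]
    have hxN := hN x (hKU hx) 1
    rw [hGU x (hKU hx), φ.right_inv (hsub hxN), e]

/-! ### The differential at boundary points -/

theorem coord_symm_eq {z : X} {y : EuclideanSpace ℝ (Fin n)}
    (hy : y ∈ (extChartAt (𝓠 n) z).target) : coord z ((extChartAt (𝓠 n) z).symm y) = y :=
  (extChartAt (𝓠 n) z).right_inv hy

theorem tendsto_extChartAt_symm (z : X) :
    Tendsto (extChartAt (𝓠 n) z).symm (𝓝[range (𝓠 n)] extChartAt (𝓠 n) z z) (𝓝 z) := by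
  have := continuousAt_extChartAt_symm (I := 𝓠 n) z
  rw [ContinuousAt, extChartAt_to_inv] at this
  exact this.mono_left nhdsWithin_le_nhds

/-- If a function with nonzero differential is constant on a face, then its derivative in the
direction normal to the face is nonzero. -/
theorem IsFaceAt.differential_single_ne_zero (hh : ContMDiff (𝓠 n) 𝓘(ℝ, ℝ) ∞ h) {z : X}
    (hsurj : Function.Surjective (differential (n := n) h z)) {S : Set X} {j : Fin n}
    (hS : IsFaceAt S z j) (hconst : ∀ x ∈ S, h x = h z) :
    differential h z (EuclideanSpace.single j 1) ≠ 0 := by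
  set φ := extChartAt (𝓠 n) z
  have hd := hasFDerivWithinAt_differential hh z
  let F : Set (EuclideanSpace ℝ (Fin n)) := {y | y ∈ range (𝓠 n) ∧ y j = 0}
  have hF : F ⊆ range (𝓠 n) := fun y hy => hy.1
  have hloc : ∀ᶠ y in 𝓝[F] φ z, (h ∘ φ.symm) y = (h ∘ φ.symm) (φ z) := by
    have h₁ := ((tendsto_extChartAt_symm z).eventually hS.2).filter_mono (nhdsWithin_mono _ hF)
    have h₂ : ∀ᶠ y in 𝓝[F] φ z, y ∈ φ.target :=
      nhdsWithin_mono _ hF (extChartAt_target_mem_nhdsWithin z)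
    filter_upwards [h₁, h₂, eventually_mem_nhdsWithin] with y h₁ h₂ h₃
    have : φ.symm y ∈ S := h₁.2 (by rw [coord_symm_eq h₂]; exact h₃.2)
    simp only [Function.comp_apply, hconst _ this]
    rw [extChartAt_to_inv z]
  -- the derivative vanishes along the face, by one-sided extremality in the directions of the axes
  have htan : ∀ k, k ≠ j → differential h z (EuclideanSpace.single k 1) = 0 := by
    intro k hk
    have hcone : EuclideanSpace.single k (1 : ℝ) ∈ posTangentConeAt F (φ z) := by
      refine mem_posTangentConeAt_of_segment_subset ?_
      rw [segment_eq_image']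
      rintro _ ⟨s, hs, rfl⟩
      simp only [add_sub_cancel_left]
      refine ⟨add_smul_single_mem_range (mem_range_self _) k hs.1, ?_⟩
      have : φ z j = 0 := hS.1
      simp [this, hk.symm]
    have hmin : IsLocalMinOn (h ∘ φ.symm) F (φ z) := hloc.mono fun y hy => hy.ge
    have hmax : IsLocalMaxOn (h ∘ φ.symm) F (φ z) := hloc.mono fun y hy => hy.le
    exact le_antisymm (hmax.hasFDerivWithinAt_nonpos (hd.mono hF) hcone)
      (hmin.hasFDerivWithinAt_nonneg (hd.mono hF) hcone)
  intro h0
  have hzero : differential (n := n) h z = 0 := by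
    refine ContinuousLinearMap.coe_injective
      ((EuclideanSpace.basisFun (Fin n) ℝ).toBasis.ext fun k => ?_)
    by_cases hk : k = j
    · simpa [hk] using h0
    · simpa using htan k hk
  obtain ⟨v, hv⟩ := hsurj 1
  simp [hzero] at hv

theorem single_mem_posTangentConeAt (z : X) (j : Fin n) :
    EuclideanSpace.single j (1 : ℝ) ∈
      posTangentConeAt (range (𝓠 n)) (extChartAt (𝓠 n) z z) := by
  refine mem_posTangentConeAt_of_segment_subset ?_
  rw [segment_eq_image']
  rintro _ ⟨s, hs, rfl⟩
  simp only [add_sub_cancel_left]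
  exact add_smul_single_mem_range (mem_range_self _) j hs.1

theorem differential_single_nonneg (hh : ContMDiff (𝓠 n) 𝓘(ℝ, ℝ) ∞ h) {z : X}
    (hmin : ∀ x, h z ≤ h x) (j : Fin n) : 0 ≤ differential h z (EuclideanSpace.single j 1) := by
  have : IsLocalMinOn (h ∘ (extChartAt (𝓠 n) z).symm) (range (𝓠 n)) (extChartAt (𝓠 n) z z) :=
    Eventually.of_forall fun y => by
      simpa only [Function.comp_apply, extChartAt_to_inv] using hmin _
  exact this.hasFDerivWithinAt_nonneg (hasFDerivWithinAt_differential hh z)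
    (single_mem_posTangentConeAt z j)

theorem differential_single_nonpos (hh : ContMDiff (𝓠 n) 𝓘(ℝ, ℝ) ∞ h) {z : X}
    (hmax : ∀ x, h x ≤ h z) (j : Fin n) : differential h z (EuclideanSpace.single j 1) ≤ 0 := by
  have : IsLocalMaxOn (h ∘ (extChartAt (𝓠 n) z).symm) (range (𝓠 n)) (extChartAt (𝓠 n) z z) :=
    Eventually.of_forall fun y => by
      simpa only [Function.comp_apply, extChartAt_to_inv] using hmax _
  exact this.hasFDerivWithinAt_nonpos (hasFDerivWithinAt_differential hh z)
    (single_mem_posTangentConeAt z j)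

/-- By invariance of the boundary, it is given in every preferred chart by the vanishing of some
coordinate. -/
theorem mem_boundary_iff_coord [IsManifold (𝓠 n) ∞ X] {z x : X}
    (hx : x ∈ (extChartAt (𝓠 n) z).source) :
    x ∈ (𝓠 n).boundary X ↔ ∃ i : Fin n, coord z x i = 0 := by
  have hx' : x ∈ (chartAt (EuclideanQuadrant n) z).source := by rwa [extChartAt_source] at hx
  have key := (𝓠 n).isInteriorPoint_iff_of_mem_atlas (n := ∞) (by simp)
    (chart_mem_atlas (EuclideanQuadrant n) z) hx'
  have hint : interior (range (𝓠 n)) = {y | ∀ i, 0 < y i} := by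
    rw [← interior_euclideanQuadrant]
    exact congrArg interior (range_euclideanQuadrant n)
  have htarget : coord z x ∈ interior (extChartAt (𝓠 n) z).target ↔
      coord z x ∈ interior (range (𝓠 n)) := by
    rw [mem_interior_iff_mem_nhds, mem_interior_iff_mem_nhds]
    exact eventually_congr (eventuallyEq_set.1 (extChartAt_target_eventuallyEq' hx))
  have hi : (𝓠 n).IsInteriorPoint x ↔ ∀ i : Fin n, 0 < coord z x i := by
    rw [key]
    refine htarget.trans ?_
    rw [hint]
    rfl
  rw [← ModelWithCorners.compl_interior, mem_compl_iff]
  refine (not_congr hi).trans ?_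
  push Not
  exact exists_congr fun i => ⟨fun e => le_antisymm e (coord_nonneg z x i), fun e => e.le⟩

/-- A point of the side boundary `B` away from the two ends lies on a single local face. Near it,
`B` is the whole boundary, so all faces through it are the face `B`. -/
theorem eq_of_coord_eq_zero [IsManifold (𝓠 n) ∞ X] {Xm Xp : Set X} (hX : IsCobordism n Xm Xp)
    {z : X} (hm : z ∉ Xm) (hp : z ∉ Xp) {j : Fin n} (hj : IsFaceAt (sideBoundary n Xm Xp) z j)
    {k : Fin n} (hk : coord z z k = 0) : k = j := by
  by_contra hkj
  set φ := extChartAt (𝓠 n) z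
  have hends : ∀ᶠ x in 𝓝 z, x ∉ Xm ∪ Xp :=
    (hX.isClosed_left.union hX.isClosed_right).isOpen_compl.mem_nhds (by simp [hm, hp])
  -- moving along the `j`-th axis stays in the face of `k` but leaves the face of `j`
  have hpath : Tendsto (fun s : ℝ => φ z + s • EuclideanSpace.single j (1 : ℝ)) (𝓝[>] 0)
      (𝓝[range (𝓠 n)] φ z) := by
    refine tendsto_nhdsWithin_iff.2 ⟨?_, ?_⟩
    · have : Continuous fun s : ℝ => φ z + s • EuclideanSpace.single j (1 : ℝ) := by fun_prop
      simpa using (this.tendsto 0).mono_left nhdsWithin_le_nhds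
    · exact eventually_mem_nhdsWithin.mono fun s hs =>
        add_smul_single_mem_range (mem_range_self _) j (le_of_lt hs)
  have h₁ := hpath.eventually ((tendsto_extChartAt_symm z).eventually (hj.2.and hends))
  have h₂ := hpath.eventually (extChartAt_target_mem_nhdsWithin z)
  obtain ⟨s, ⟨hface, hend⟩, htarget, hs⟩ :=
    (h₁.and (h₂.and (eventually_mem_nhdsWithin (s := Ioi (0 : ℝ))))).exists
  have hz : ∀ i, i ∈ ({j, k} : Set (Fin n)) → φ z i = 0 := by
    rintro i (rfl | rfl)
    exacts [hj.1, hk]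
  have hbd : φ.symm (φ z + s • EuclideanSpace.single j (1 : ℝ)) ∈ (𝓠 n).boundary X := by
    refine (mem_boundary_iff_coord (φ.map_target htarget)).2 ⟨k, ?_⟩
    rw [coord_symm_eq htarget]
    simp [hz k (by simp), hkj]
  have : coord z (φ.symm (φ z + s • EuclideanSpace.single j (1 : ℝ))) j = 0 :=
    hface.1 (subset_closure ⟨hbd, hend⟩)
  rw [coord_symm_eq htarget] at this
  simp [hz j (by simp)] at this
  exact hs.ne' this

variable {a b : ℝ} {π : C(X, Icc a b)}

/-! ### Local descents of a tame function -/

/-- Away from the bottom fibre there is a direction of descent that points into the manifold. -/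
theorem exists_descending_direction [IsManifold (𝓠 n) ∞ X] (hπ : IsTame n π)
    (htype : ∀ p, IsSideCritical n π p → IsTypeD n (fun x => (π x : ℝ)) (side n π) p)
    {z : X} (hz : z ∉ leftFibre π) :
    ∃ v : EuclideanSpace ℝ (Fin n), differential (fun x => (π x : ℝ)) z v < 0 ∧
      ∀ i, coord z z i = 0 → 0 ≤ v i := by
  have single_nonneg : ∀ j i : Fin n, 0 ≤ (EuclideanSpace.single j (1 : ℝ)) i := fun j i => by
    by_cases e : i = j <;> simp [e]
  by_cases hp : z ∈ rightFibre π
  · obtain ⟨j, hj⟩ := hπ.cobordism.face_right z hp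
    refine ⟨EuclideanSpace.single j 1, lt_of_le_of_ne ?_ ?_, fun i _ => single_nonneg j i⟩
    · refine differential_single_nonpos hπ.smooth (fun x => ?_) j
      have : (π z : ℝ) = b := hp
      simpa only [this] using (π x).2.2
    · exact hj.differential_single_ne_zero hπ.smooth (hπ.submersive z)
        fun x hx => Eq.trans hx (Eq.symm hp)
  by_cases hbd : z ∈ (𝓠 n).boundary X
  · have hB : z ∈ side n π := subset_closure ⟨hbd, by simp [hz, hp]⟩
    obtain ⟨j, hj⟩ := hπ.cobordism.face_side z hB
    by_cases hcrit : IsSideCritical n π z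
    · refine ⟨EuclideanSpace.single j 1, ?_, fun i _ => single_nonneg j i⟩
      have := htype z hcrit (-EuclideanSpace.single j 1) ⟨j, hj, by simp⟩
      simpa using this
    · have : ∃ v : EuclideanSpace ℝ (Fin n), v j = 0 ∧
          differential (fun x => (π x : ℝ)) z v ≠ 0 := by
        by_contra! hall
        exact hcrit ⟨hB, j, hj, hall⟩
      obtain ⟨v, hvj, hv⟩ := this
      have face : ∀ i, coord z z i = 0 → v i = 0 := fun i hi => by
        rw [eq_of_coord_eq_zero hπ.cobordism hz hp hj hi, hvj]
      rcases hv.lt_or_gt with hv | hv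
      · exact ⟨v, hv, fun i hi => (face i hi).ge⟩
      · exact ⟨-v, by simpa using hv, fun i hi => by simp [face i hi]⟩
  · obtain ⟨v, hv⟩ := hπ.submersive z (-1)
    refine ⟨v, by rw [hv]; norm_num, fun i hi => absurd ?_ hbd⟩
    exact (mem_boundary_iff_coord (mem_extChartAt_source z)).2 ⟨i, hi⟩

theorem exists_isDescent_local_of_notMem_left [T2Space X] [CompactSpace X] [IsManifold (𝓠 n) ∞ X]
    (hπ : IsTame n π)
    (htype : ∀ p, IsSideCritical n π p → IsTypeD n (fun x => (π x : ℝ)) (side n π) p)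
    {z : X} (hz : z ∉ leftFibre π) :
    ∃ G, IsDescent (fun x => (π x : ℝ)) G ∧ (π (G z 1) : ℝ) < π z := by
  obtain ⟨v, hv, hin⟩ := exists_descending_direction hπ htype hz
  set φ := extChartAt (𝓠 n) z
  -- a coordinate which is positive at `z` stays positive during a short push
  obtain ⟨δ, hδ, hdir⟩ : ∃ δ : ℝ, 0 < δ ∧ ∀ᶠ y in 𝓝[range (𝓠 n)] φ z, ∀ s, 0 ≤ s → s ≤ δ →
      y + s • v ∈ range (𝓠 n) := by
    have hcoord : ∀ i, ∀ᶠ q : EuclideanSpace ℝ (Fin n) × ℝ in 𝓝[range (𝓠 n)] φ z ×ˢ 𝓝[≥] 0,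
        0 ≤ q.1 i + q.2 * v i := by
      intro i
      rcases (coord_nonneg z z i).eq_or_lt with e | e
      · filter_upwards [prod_mem_prod (self_mem_nhdsWithin) self_mem_nhdsWithin] with q hq
        exact add_nonneg (mem_range_quadrant.1 hq.1 i) (mul_nonneg hq.2 (hin i e.symm))
      · have hc : Continuous fun q : EuclideanSpace ℝ (Fin n) × ℝ => q.1 i + q.2 * v i := by
          fun_prop
        have ht := hc.tendsto (φ z, 0)
        have e' : 0 < φ z i := e
        have := (ht.eventually_const_lt (u := 0) (by simpa using e')).filter_mono
          ((Filter.prod_mono nhdsWithin_le_nhds nhdsWithin_le_nhds).trans nhds_prod_eq.ge :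
            𝓝[range (𝓠 n)] φ z ×ˢ 𝓝[≥] (0 : ℝ) ≤ 𝓝 (φ z, 0))
        exact this.mono fun q hq => hq.le
    obtain ⟨A, hA, B, hB, hAB⟩ := mem_prod_iff.1 (eventually_all.2 hcoord)
    obtain ⟨δ, hδ, hδB⟩ := mem_nhdsGE_iff_exists_Icc_subset.1 hB
    refine ⟨δ, hδ, eventually_of_mem hA fun y hy s h₀ h₁ => mem_range_quadrant.2 fun i => ?_⟩
    simpa using hAB (mk_mem_prod hy (hδB ⟨h₀, h₁⟩)) i
  obtain ⟨ε, hε, G, hG, hpush⟩ := exists_isDescent_push hπ.smooth hv (m := fun _ => δ)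
    continuous_const (fun _ _ => hδ.le) hdir
  refine ⟨G, hG, lt_of_le_of_ne (hG.le z 1) fun e => ?_⟩
  have e₁ := hpush.self_of_nhds
  rw [hG.eq_of_height_eq e, left_eq_add, smul_eq_zero] at e₁
  rcases e₁ with e₁ | e₁
  · exact (lt_min hε hδ).ne' e₁
  · simp [e₁] at hv

/-- Near the bottom fibre, given by `x_j = 0` in a chart, the descent is along the `j`-th axis and
lasts for the time `x_j` that it takes to reach the fibre. -/
theorem exists_isDescent_local_of_mem_left [T2Space X] [CompactSpace X] [IsManifold (𝓠 n) ∞ X]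
    (hπ : IsTame n π) {z : X} (hz : z ∈ leftFibre π) :
    ∃ G, IsDescent (fun x => (π x : ℝ)) G ∧ ∀ᶠ x in 𝓝 z, (π (G x 1) : ℝ) = a := by
  obtain ⟨j, hj⟩ := hπ.cobordism.face_left z hz
  have hza : (π z : ℝ) = a := hz
  have hv : differential (fun x => (π x : ℝ)) z (-EuclideanSpace.single j 1) < 0 := by
    rw [map_neg, neg_lt_zero]
    refine lt_of_le_of_ne (differential_single_nonneg hπ.smooth (fun x => ?_) j) (Ne.symm ?_)
    · simpa only [hza] using (π x).2.1
    · exact hj.differential_single_ne_zero hπ.smooth (hπ.submersive z)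
        fun x hx => Eq.trans hx (Eq.symm hz)
  obtain ⟨ε, hε, G, hG, hpush⟩ := exists_isDescent_push hπ.smooth hv (m := fun y => y j)
    (by fun_prop) (fun y hy => mem_range_quadrant.1 hy j) (by
      filter_upwards [self_mem_nhdsWithin] with y hy s h₀ h₁
      refine mem_range_quadrant.2 fun i => ?_
      by_cases e : i = j
      · simpa [e] using h₁
      · simpa [e] using mem_range_quadrant.1 hy i)
  refine ⟨G, hG, ?_⟩
  have hGz : G z 1 = z := hG.eq_of_height_eq
    (le_antisymm (hG.le z 1) (by rw [hza]; exact (π (G z 1)).2.1))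
  have hlim : Tendsto (fun x => G x 1) (𝓝 z) (𝓝 z) := by
    simpa only [hGz] using (hG.continuous_at_time 1).tendsto z
  have hsmall : ∀ᶠ x in 𝓝 z, extChartAt (𝓠 n) z x j < ε := by
    have hc : ContinuousAt (fun x => extChartAt (𝓠 n) z x j) z :=
      (by fun_prop : Continuous fun y : EuclideanSpace ℝ (Fin n) => y j).continuousAt.comp
        (continuousAt_extChartAt z)
    exact hc.tendsto.eventually_lt_const
      (by rw [show extChartAt (𝓠 n) z z j = 0 from hj.1]; exact hε)
  filter_upwards [hpush, hsmall, hlim.eventually hj.2] with x h₁ h₂ h₃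
  refine h₃.2 ?_
  rw [min_eq_right h₂.le] at h₁
  rw [coord, h₁]
  simp

theorem IsTame.exists_lowering [T2Space X] [CompactSpace X] [IsManifold (𝓠 n) ∞ X]
    (hπ : IsTame n π)
    (htype : ∀ p, IsSideCritical n π p → IsTypeD n (fun x => (π x : ℝ)) (side n π) p) :
    ∃ Φ : C(X × Icc a b, X), (∀ x t, π (Φ (x, t)) = min (π x) t) ∧
      ∀ x t, π x ≤ t → Φ (x, t) = x := by
  obtain ⟨G, T, hT, hG, hbot⟩ := exists_isDescent_to_bottom (h := fun x => (π x : ℝ)) (a := a)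
    (fun x => (π x).2.1) (by fun_prop) fun z => by
      by_cases hz : z ∈ leftFibre π
      · obtain ⟨G, hG, hev⟩ := exists_isDescent_local_of_mem_left hπ hz
        exact ⟨G, hG, fun e => absurd (show (π z : ℝ) = a from hz) e.ne', fun _ => hev⟩
      · obtain ⟨G, hG, hlt⟩ := exists_isDescent_local_of_notMem_left hπ htype hz
        exact ⟨G, hG, fun _ => hlt, fun e => absurd e hz⟩
  exact TameFunctions.exists_lowering π hT hG hbot

end LocalDescent

end TameFunctions

theorem proposition3p6 (n : ℕ) {X : Type*} [TopologicalSpace X] [T2Space X] [CompactSpace X]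
    [ChartedSpace (EuclideanQuadrant n) X]
    [IsManifold (modelWithCornersEuclideanQuadrant n) ∞ X]
    {a b : ℝ} (hab : a < b) (π : C(X, Icc a b)) (hπ : TameFunctions.IsTame n π)
    (hcrit : ∃! p : X, TameFunctions.IsSideCritical n π p)
    (htype : ∀ p : X, TameFunctions.IsSideCritical n π p →
      TameFunctions.IsTypeD n (fun x => (π x : ℝ)) (TameFunctions.side n π) p) :
    TameFunctions.IsZeroSectional hab π ∧
    ∀ γ : C(Icc a b, X), TameFunctions.IsEndPath hab π γ →
      ∃ σ : C(Icc a b, X), TameFunctions.IsSection π σ ∧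
        γ.HomotopicWith σ (TameFunctions.IsEndPath hab π) ∧
        ∀ σ' : C(Icc a b, X), TameFunctions.IsSection π σ' →
          γ.HomotopicWith σ' (TameFunctions.IsEndPath hab π) →
          σ.HomotopicWith σ' (TameFunctions.IsSection π) := by
  obtain ⟨Φ, hΦ, hΦ'⟩ := hπ.exists_lowering htype
  refine ⟨TameFunctions.isZeroSectional_of_lowering hab hΦ hΦ', fun γ hγ => ?_⟩
  have hσ := TameFunctions.isSection_sectionBelow hab hΦ hγ
  have hγσ := hγ.homotopicWith_sectionBelow hab hΦ hΦ'
  exact ⟨_, hσ, hγσ, fun σ' hσ' H =>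
    hσ.homotopicWith_of_isEndPath hab hΦ hΦ' hσ' (hγσ.symm.trans H)⟩
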